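/- \textbf{Model.} $n$ nodes, one of them a distinguished leader $\ell$, the others identical and without identifiers, communicate in synchronous rounds. In every round the links form a connected undirected graph on the nodes, which may change arbitrarily from round to round, with all degrees at most $\Delta$. In each round every node broadcasts one message to its current neighbours and receives the multiset of their messages. Nodes know $\Delta$ but not $n$. \textbf{Counting Protocol} (with a real constant $c>1$). For $k=2,3,\dots$ the nodes perform three phases; at the beginning the leader sets $e_\ell\leftarrow 0$ and $\mathit{IsCorrect}\leftarrow$ true, and every other node sets $e\leftarrow 1$. (1) Collection, $\tau(k)=k\lceil(2\Delta)^k\ln k\rceil$ rounds: in each round the leader broadcasts $0$ and every other node broadcasts its energy $e$. On receiving $e_1,\dots,e_s$, the leader sets $e_\ell\leftarrow e_\ell+\sum_i e_i/(2\Delta)$, and every other node sets $e\leftarrow e+\sum_i e_i/(2\Delta)-s\,e/(2\Delta)$. (2) Verification, $\lceil 1+k/(1-1/k^c)\rceil$ rounds: every non-leader broadcasts the largest energy it knows of (initially its own $e$) and updates this maximum with what it receives. The leader sets $\mathit{IsCorrect}\leftarrow$ false if it receives a value larger than $1/k^c$, or if $e_\ell>k-1$. (Optionally, it also does so if $e_\ell<k-1-1/k^c$;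 the theorem holds for both variants.) (3) Notification, $k$ rounds: if $\mathit{IsCorrect}$ is true, the leader broadcasts $\langle \mathit{Halt}\rangle$ in each round, and every node that has received $\langle \mathit{Halt}\rangle$ broadcasts it in the following rounds. At the end of the phase the leader (if $\mathit{IsCorrect}$) and every node that has received $\langle\mathit{Halt}\rangle$ stop, holding $k$; the other nodes go on to $k+1$. \textbf{Theorem.} Let $n>6$, $1\le\Delta\le n-1$, and $1<c\le 2^n$ (so every constant $c$ with $1<c\le 128$ is allowed for all $n>6$, and every constant $c>1$ for all $n\ge\max\{7,\log_2 c\}$). For every such dynamic network of $n$ nodes there is a number of rounds $$r<\frac{(2\Delta)^{n+1}(n+1)\ln(n+1)}{\ln(2\Delta)}$$ such that after $r$ rounds of the Counting Protocol all nodes have stopped, holding the size $n$ of the network. -/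

import Mathlib

namespace AnonDynNet

/-- A deterministic protocol for a synchronous anonymous network with a leader. A node knows
initially only whether it is the leader. In each round it broadcasts one message and receives
the multiset of the messages of its current neighbours (senders cannot be distinguished). -/
structure Protocol (σ μ : Type) where
  init : Bool → σ
  send : σ → μ
  step : σ → Multiset μ → σ

/-- The state of node `v` after `r` rounds, when `G r` is the topology in the round that follows
the first `r` rounds. -/
def Protocol.run {σ μ : Type} (P : Protocol σ μ) {V : Type*} [Fintype V] [DecidableEq V]
    (l : V) (G : ℕ → SimpleGraph V) [∀ r, DecidableRel (G r).Adj] : ℕ → V → σ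
  | 0, v => P.init (decide (v = l))
  | r + 1, v =>
      P.step (P.run l G r v) (((G r).neighborFinset v).val.map fun w => P.send (P.run l G r w))

/-- Messages: an amount of energy, the message `Halt`, or nothing. -/
inductive Msg where
  | energy (e : ℝ)
  | halt
  | silent

/-- The energy named in a message (`0` if there is none). -/
def Msg.value : Msg → ℝ
  | .energy e => e
  | .halt => 0
  | .silent => 0

/-- The three phases of the iteration for one size estimate. -/
inductive Phase where
  | collection
  | verification
  | notification

/-- Local state of a node: `k` is the current estimate, `t` the number of completed rounds of the
current phase, `maxEnergy` the largest energy that a non-leader knows of in the verification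
phase. The bit `flag` is `IsCorrect` at the leader; at any other node it says whether the message
`Halt` was received in the current iteration. -/
structure State where
  isLeader : Bool
  k : ℕ
  phase : Phase
  t : ℕ
  energy : ℝ
  maxEnergy : ℝ
  flag : Bool
  halted : Bool

/-- A node that has stopped holds its last estimate; one that has not stopped holds no answer. -/
def State.output (s : State) : Option ℕ := if s.halted then some s.k else none

/-- Beginning of the iteration for the estimate `k`: the energy of the leader is reset to `0`, that
of every other node to `1`. -/
def startIteration (isLeader : Bool) (k : ℕ) : State where
  isLeader := isLeader
  k := k
  phase := .collection
  t := 0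
  energy := if isLeader then 0 else 1
  maxEnergy := 0
  flag := isLeader
  halted := false

/-- Length of the collection phase, `k ⌈(2Δ)^k ln k⌉`. -/
noncomputable def collectionRounds (Δ k : ℕ) : ℕ :=
  k * ⌈(2 * (Δ : ℝ)) ^ k * Real.log k⌉₊

/-- Length of the verification phase, `⌈1 + k / (1 - 1 / k^c)⌉`. -/
noncomputable def verificationRounds (c : ℝ) (k : ℕ) : ℕ :=
  ⌈1 + (k : ℝ) / (1 - 1 / (k : ℝ) ^ c)⌉₊

/-- What a node broadcasts. The leader never gives energy away. -/
def countingSend (s : State) : Msg :=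
  if s.halted then .silent
  else match s.phase with
    | .collection => .energy (if s.isLeader then 0 else s.energy)
    | .verification => if s.isLeader then .silent else .energy s.maxEnergy
    | .notification => if s.flag then .halt else .silent

/-- A round of the collection phase: each non-leader passes the fraction `1/(2Δ)` of its energy
to each of its neighbours. The leader only collects. -/
noncomputable def collectionStep (Δ : ℕ) (s : State) (m : Multiset Msg) : State :=
  let gain := (m.map Msg.value).sum / (2 * (Δ : ℝ))
  let loss := if s.isLeader then 0 else s.energy * (Multiset.card m : ℝ) / (2 * (Δ : ℝ))
  let e := s.energy + gain - loss
  if s.t + 1 < collectionRounds Δ s.k then { s with energy := e, t := s.t + 1 }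
  else { s with energy := e, maxEnergy := e, t := 0, phase := .verification }

/-- The leader's test of its own energy: `e ≤ k - 1` and, if `lowerTest` is set, also
`k - 1 - 1/k^c ≤ e`. -/
def EnergyOK (c : ℝ) (lowerTest : Bool) (k : ℕ) (e : ℝ) : Prop :=
  e ≤ (k : ℝ) - 1 ∧ (lowerTest = true → (k : ℝ) - 1 - 1 / (k : ℝ) ^ c ≤ e)

open Classical in
/-- A round of the verification phase: non-leaders spread the maximum energy, and the leader rejects
the estimate if it hears of an energy above `1/k^c`. After the last round the leader also tests
its own energy. -/
noncomputable def verificationStep (c : ℝ) (lowerTest : Bool) (s : State) (m : Multiset Msg) :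
    State :=
  let mx := (m.map Msg.value).fold max s.maxEnergy
  let ok := s.flag && decide (∀ x ∈ m, x.value ≤ 1 / (s.k : ℝ) ^ c)
  if s.t + 1 < verificationRounds c s.k then
    if s.isLeader then { s with flag := ok, t := s.t + 1 }
    else { s with maxEnergy := mx, t := s.t + 1 }
  else
    if s.isLeader then
      { s with
        flag := ok && decide (EnergyOK c lowerTest s.k s.energy), t := 0, phase := .notification }
    else { s with maxEnergy := mx, t := 0, phase := .notification }

open Classical in
/-- A round of the notification phase, which has `k` rounds. The message `Halt` is broadcast by the
leader, if it has accepted the estimate, and by all nodes that have received it. At the end of the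
phase the nodes involved stop, and the others go on to the estimate `k + 1`. -/
noncomputable def notificationStep (s : State) (m : Multiset Msg) : State :=
  let f := if s.isLeader then s.flag else s.flag || decide (Msg.halt ∈ m)
  if s.t + 1 < s.k then { s with flag := f, t := s.t + 1 }
  else if f then { s with flag := f, halted := true }
  else startIteration s.isLeader (s.k + 1)

/-- The Counting Protocol for maximum degree `Δ` and exponent `c`. The first estimate is `2`; a node
that has stopped stays as it is. -/
noncomputable def countingProtocol (Δ : ℕ) (c : ℝ) (lowerTest : Bool) : Protocol State Msg where
  init isLeader := startIteration isLeader 2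
  send := countingSend
  step s m :=
    if s.halted then s
    else match s.phase with
      | .collection => collectionStep Δ s m
      | .verification => verificationStep c lowerTest s m
      | .notification => notificationStep s m

end AnonDynNet

/-! Let B = 1/k^c. Energy diffuses between non-leaders and is absorbed by the leader, with total n -
1 throughout.

If k < n, suppose that the leader accepts. Following the verification rounds backwards in time,
connectivity gives a set T containing the leader, either all of V or larger than the number of
rounds, whose other members have energy at most B (`HeardOnlySmall.exists_card_le`). Nodes outside T
have energy at most 1 and the leader at most k - 1, so (|T| - 1)(1 - B) ≤ k - 1. This fails for both
sizes of T (`not_accept_of_lt`).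

If k = n, consider the sum of squares of the non-leader energies. One round lowers it by at least
1/(4Δ) of a Dirichlet energy, and a Poincaré inequality makes this a contraction by 1 - 1/(4Δn²)
(`potential_collect_le`). The estimate holds round by round, so a changing topology does no harm.
The collection phase is long enough to leave at most n^(-c) outside the leader (`sum_offered_le`);
hence every test passes (`accept_card`) and `Halt` floods the network within n rounds.

The lengths of the iterations grow geometrically, so their sum is at most twice the leading term
(`sum_iterationRounds_le`). -/

namespace AnonDynNet

/-! ### Diffusion of energy in the collection phase -/

section Energy

variable {V : Type*} [Fintype V]

/-- Every proper nonempty set of nodes of a connected graph has an edge leaving it. -/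
theorem exists_adj_of_connected {G : SimpleGraph V} (hG : G.Connected) {S : Finset V} {a : V}
    (ha : a ∈ S) (hS : S ≠ Finset.univ) : ∃ u ∈ S, ∃ w, w ∉ S ∧ G.Adj u w := by
  obtain ⟨b, hb⟩ : ∃ b, b ∉ S := by
    by_contra! h
    exact hS (Finset.eq_univ_iff_forall.2 h)
  obtain ⟨p⟩ := hG.preconnected a b
  obtain ⟨d, -, h1, h2⟩ := p.exists_boundary_dart (S : Set V) (by simpa using ha) (by simpa using hb)
  exact ⟨d.fst, by simpa using h1, d.snd, by simpa using h2, d.adj⟩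

theorem sum_neighborFinset_comm (G : SimpleGraph V) [DecidableRel G.Adj] (f : V → V → ℝ) :
    ∑ v, ∑ w ∈ G.neighborFinset v, f v w = ∑ v, ∑ w ∈ G.neighborFinset v, f w v := by
  simp only [SimpleGraph.neighborFinset_eq_filter, Finset.sum_filter]
  rw [Finset.sum_comm]
  simp only [G.adj_comm]

/-- The Dirichlet energy, each edge counted in both directions. -/
def dirichlet (G : SimpleGraph V) [DecidableRel G.Adj] (y : V → ℝ) : ℝ :=
  ∑ v, ∑ w ∈ G.neighborFinset v, (y w - y v) ^ 2

/-- As a sum over darts, the Dirichlet energy can be compared with the sum along a single path. -/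
theorem sum_darts (G : SimpleGraph V) [DecidableRel G.Adj] (f : V → V → ℝ) :
    ∑ d : G.Dart, f d.fst d.snd = ∑ v, ∑ w ∈ G.neighborFinset v, f v w := by
  rw [Finset.sum_sigma']
  refine Finset.sum_bij (fun d _ => ⟨d.fst, d.snd⟩) ?_ ?_ ?_ ?_
  · intro d _
    simp
  · rintro ⟨⟨a, b⟩, h⟩ _ ⟨⟨a', b'⟩, h'⟩ _ e
    simp at e
    simp [e]
  · rintro ⟨a, b⟩ h
    refine ⟨⟨(a, b), by simpa using h⟩, Finset.mem_univ _, rfl⟩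
  · intros
    rfl

theorem sub_eq_sum_darts {V : Type*} {G : SimpleGraph V} (y : V → ℝ) {a b : V} (p : G.Walk a b) :
    y b - y a = (p.darts.map fun d => y d.snd - y d.fst).sum := by
  induction p with
  | nil => simp
  | cons h p ih => simp [← ih]

variable [DecidableEq V]

/-- On a connected graph the Dirichlet energy controls every value of a function vanishing
somewhere. -/
theorem sq_le_card_mul_dirichlet {G : SimpleGraph V} [DecidableRel G.Adj] (hG : G.Connected)
    {y : V → ℝ} {l : V} (hl : y l = 0) (v : V) :
    y v ^ 2 ≤ Fintype.card V * dirichlet G y := by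
  -- A path repeats no dart and has fewer than n of them; Cauchy–Schwarz is applied to the
  -- telescoping sum of increments along it.
  obtain ⟨p, hp⟩ := hG.exists_isPath l v
  have hnd : p.darts.Nodup := p.darts_nodup_of_support_nodup hp.support_nodup
  have h1 : y v = ∑ d ∈ p.darts.toFinset, (y d.snd - y d.fst) := by
    rw [List.sum_toFinset _ hnd, ← sub_eq_sum_darts, hl, sub_zero]
  have hcard : (p.darts.toFinset.card : ℝ) ≤ Fintype.card V := by
    rw [List.toFinset_card_of_nodup hnd, p.length_darts]
    exact_mod_cast hp.length_lt.le
  calc y v ^ 2 ≤ p.darts.toFinset.card * ∑ d ∈ p.darts.toFinset, (y d.snd - y d.fst) ^ 2 := by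
        rw [h1]; exact sq_sum_le_card_mul_sum_sq
    _ ≤ Fintype.card V * ∑ d : G.Dart, (y d.snd - y d.fst) ^ 2 := by
        gcongr
        exact Finset.subset_univ _
    _ = _ := by
        rw [sum_darts G fun a b => (y b - y a) ^ 2, dirichlet]

/-- The energy that a node broadcasts: the leader's is kept. -/
def offered (l : V) (x : V → ℝ) (v : V) : ℝ := if v = l then 0 else x v

/-- The effect of a collection round on the energies. -/
noncomputable def collect (Δ : ℕ) (G : SimpleGraph V) [DecidableRel G.Adj] (l : V) (x : V → ℝ)
    (v : V) : ℝ :=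
  x v + (∑ w ∈ G.neighborFinset v, offered l x w) / (2 * (Δ : ℝ))
    - offered l x v * (G.degree v : ℝ) / (2 * (Δ : ℝ))

section Step

variable {Δ : ℕ} {G : SimpleGraph V} [DecidableRel G.Adj] {l : V} {x : V → ℝ}

theorem sum_collect : ∑ v, collect Δ G l x v = ∑ v, x v := by
  have h : ∑ v, ∑ w ∈ G.neighborFinset v, offered l x w = ∑ v, offered l x v * (G.degree v : ℝ) := by
    rw [sum_neighborFinset_comm G fun _ w => offered l x w]
    simp [mul_comm]
  simp only [collect, Finset.sum_sub_distrib, Finset.sum_add_distrib, ← Finset.sum_div, h]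
  ring

omit [Fintype V] in
theorem offered_nonneg (h : ∀ v, 0 ≤ x v) (v : V) : 0 ≤ offered l x v := by
  unfold offered; split_ifs <;> simp [h]

theorem collect_nonneg (hΔ : 1 ≤ Δ) (hdeg : ∀ v, G.degree v ≤ Δ) (h : ∀ v, 0 ≤ x v) (v : V) :
    0 ≤ collect Δ G l x v := by
  have hD : (1 : ℝ) ≤ Δ := by exact_mod_cast hΔ
  have hd : (G.degree v : ℝ) ≤ Δ := by exact_mod_cast hdeg v
  have h1 : 0 ≤ (∑ w ∈ G.neighborFinset v, offered l x w) / (2 * (Δ : ℝ)) :=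
    div_nonneg (Finset.sum_nonneg fun w _ => offered_nonneg h w) (by positivity)
  have h2 : offered l x v * (G.degree v : ℝ) / (2 * (Δ : ℝ)) ≤ x v := by
    rw [div_le_iff₀ (by positivity)]
    have h3 : offered l x v ≤ x v := by
      unfold offered; split_ifs <;> simp [h]
    have := h v
    nlinarith [mul_le_mul h3 hd (by positivity) this]
  unfold collect
  linarith

/-- The new energy is the old one with weight 1 - deg/(2Δ) plus offered energies with weight 1/(2Δ)
each, a convex combination. The leader may exceed 1, but it offers 0. -/
theorem collect_le_one (hΔ : 1 ≤ Δ) (hdeg : ∀ v, G.degree v ≤ Δ)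
    (h1 : ∀ v, v ≠ l → x v ≤ 1) {v : V} (hv : v ≠ l) : collect Δ G l x v ≤ 1 := by
  have hD : (1 : ℝ) ≤ Δ := by exact_mod_cast hΔ
  have hd : (G.degree v : ℝ) ≤ Δ := by exact_mod_cast hdeg v
  have hs : ∑ w ∈ G.neighborFinset v, offered l x w ≤ G.degree v := by
    calc _ ≤ ∑ w ∈ G.neighborFinset v, (1 : ℝ) := Finset.sum_le_sum fun w _ => by
          unfold offered; split_ifs with hw
          · exact zero_le_one
          · exact h1 w hw
      _ = _ := by simp
  have hx := h1 v hv
  have ho : offered l x v = x v := by simp [offered, hv]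
  unfold collect
  rw [ho]
  have : (∑ w ∈ G.neighborFinset v, offered l x w) / (2 * (Δ : ℝ))
      - x v * (G.degree v : ℝ) / (2 * (Δ : ℝ)) ≤ 1 - x v := by
    rw [← sub_div, div_le_iff₀ (by positivity)]
    nlinarith [mul_nonneg (sub_nonneg.2 hx) (sub_nonneg.2 hd), mul_nonneg (sub_nonneg.2 hx) (by positivity : (0 : ℝ) ≤ Δ)]
  linarith

/-- The quadratic potential of the energies outside the leader. -/
def potential (l : V) (x : V → ℝ) : ℝ := ∑ v, offered l x v ^ 2

/-- Expand the square of y v + s/(2Δ), where s is the sum of the differences y w - y v. Summed over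
v, the cross terms give -D/(2Δ), with D the Dirichlet energy; by Cauchy–Schwarz and the degree bound
the squares give at most D/(4Δ). -/
theorem potential_collect_le_sub (hΔ : 1 ≤ Δ) (hdeg : ∀ v, G.degree v ≤ Δ) :
    potential l (collect Δ G l x) ≤ potential l x - dirichlet G (offered l x) / (4 * Δ) := by
  have hD : (0 : ℝ) < Δ := by exact_mod_cast hΔ
  set y := offered l x with hy
  have hyl : y l = 0 := by simp [hy, offered]
  -- At the leader the left side and the first two terms on the right vanish, so the bound can be
  -- summed over all nodes.
  have key : ∀ v, offered l (collect Δ G l x) v ^ 2 ≤ y v ^ 2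
      + (∑ w ∈ G.neighborFinset v, (y w - y v) * y v) / Δ
      + (∑ w ∈ G.neighborFinset v, (y w - y v) ^ 2) / (4 * Δ) := by
    intro v
    have hnn : 0 ≤ (∑ w ∈ G.neighborFinset v, (y w - y v) ^ 2) / (4 * (Δ : ℝ)) :=
      div_nonneg (Finset.sum_nonneg fun _ _ => sq_nonneg _) (by positivity)
    by_cases hv : v = l
    · subst hv
      simp only [hyl, mul_zero, Finset.sum_const_zero, sub_zero, zero_div, add_zero] at hnn ⊢
      simp only [offered, if_true]
      simpa using hnn
    · have hcol : offered l (collect Δ G l x) v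
          = y v + (∑ w ∈ G.neighborFinset v, (y w - y v)) / (2 * Δ) := by
        have hyv : x v = y v := by simp [hy, offered, hv]
        simp only [offered, if_neg hv]
        simp only [collect, Finset.sum_sub_distrib, hyv, ← hy]
        simp
        ring
      have hcs : (∑ w ∈ G.neighborFinset v, (y w - y v)) ^ 2
          ≤ Δ * ∑ w ∈ G.neighborFinset v, (y w - y v) ^ 2 := by
        refine sq_sum_le_card_mul_sum_sq.trans ?_
        gcongr
        simpa using hdeg v
      rw [hcol, ← Finset.sum_mul]
      have : (∑ w ∈ G.neighborFinset v, (y w - y v)) ^ 2 / (4 * Δ ^ 2)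
          ≤ (∑ w ∈ G.neighborFinset v, (y w - y v) ^ 2) / (4 * (Δ : ℝ)) := by
        rw [div_le_div_iff₀ (by positivity) (by positivity)]
        nlinarith
      refine le_trans (le_of_eq ?_) (add_le_add_right this _)
      field_simp
      ring
  -- Averaging over the two orientations of an edge turns the cross terms into -(y w - y v)²/2.
  have hcross : ∑ v, ∑ w ∈ G.neighborFinset v, (y w - y v) * y v = - dirichlet G y / 2 := by
    have h := sum_neighborFinset_comm G fun v w => (y w - y v) * y v
    have h2 : ∑ v, ∑ w ∈ G.neighborFinset v, (y w - y v) * y v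
        + ∑ v, ∑ w ∈ G.neighborFinset v, (y v - y w) * y w = -dirichlet G y := by
      simp only [dirichlet, ← Finset.sum_add_distrib, ← Finset.sum_neg_distrib]
      refine Finset.sum_congr rfl fun v _ => Finset.sum_congr rfl fun w _ => ?_
      ring
    linarith
  calc potential l (collect Δ G l x) ≤ ∑ v, (y v ^ 2
      + (∑ w ∈ G.neighborFinset v, (y w - y v) * y v) / Δ
      + (∑ w ∈ G.neighborFinset v, (y w - y v) ^ 2) / (4 * Δ)) :=
        Finset.sum_le_sum fun v _ => key v
    _ = potential l x + (- dirichlet G y / 2) / Δ + dirichlet G y / (4 * Δ) := by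
        rw [Finset.sum_add_distrib, Finset.sum_add_distrib, ← Finset.sum_div, ← Finset.sum_div,
          hcross]
        rfl
    _ = _ := by field_simp; ring

/-- Summing the pointwise Poincaré bound over the nodes gives potential ≤ n² · Dirichlet energy,
since `offered` vanishes at the leader. -/
theorem potential_collect_le (hG : G.Connected) (hΔ : 1 ≤ Δ) (hdeg : ∀ v, G.degree v ≤ Δ) :
    potential l (collect Δ G l x)
      ≤ potential l x * (1 - 1 / (4 * Δ * (Fintype.card V : ℝ) ^ 2)) := by
  have hD : (0 : ℝ) < Δ := by exact_mod_cast hΔ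
  have hn : (0 : ℝ) < Fintype.card V := by exact_mod_cast Fintype.card_pos_iff.2 ⟨l⟩
  refine (potential_collect_le_sub hΔ hdeg).trans ?_
  have h : potential l x ≤ (Fintype.card V : ℝ) ^ 2 * dirichlet G (offered l x) := by
    calc potential l x ≤ ∑ _v : V, (Fintype.card V : ℝ) * dirichlet G (offered l x) :=
          Finset.sum_le_sum fun v _ =>
            sq_le_card_mul_dirichlet hG (l := l) (if_pos rfl) v
      _ = _ := by simp; ring
  have : potential l x * (1 / (4 * Δ * (Fintype.card V : ℝ) ^ 2))
      ≤ dirichlet G (offered l x) / (4 * Δ) := by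
    rw [mul_one_div, div_le_div_iff₀ (by positivity) (by positivity)]
    nlinarith
  linarith

end Step

/-- The energies after `j` collection rounds that begin after the first `b` rounds. -/
noncomputable def collectSeq (Δ : ℕ) (l : V) (G : ℕ → SimpleGraph V)
    [∀ r, DecidableRel (G r).Adj] (b : ℕ) : ℕ → V → ℝ
  | 0 => fun v => if v = l then 0 else 1
  | j + 1 => collect Δ (G (b + j)) l (collectSeq Δ l G b j)

section Seq

variable {Δ : ℕ} {l : V} {G : ℕ → SimpleGraph V} [∀ r, DecidableRel (G r).Adj] {b : ℕ}

theorem sum_collectSeq (j : ℕ) :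
    ∑ v, collectSeq Δ l G b j v = (Fintype.card V : ℝ) - 1 := by
  induction j with
  | zero =>
    have : ∀ v, collectSeq Δ l G b 0 v = 1 - if v = l then 1 else 0 := by
      intro v; simp only [collectSeq]; split_ifs <;> simp
    simp [this, Finset.sum_sub_distrib]
  | succ j ih => rw [← ih]; exact sum_collect

theorem collectSeq_nonneg (hΔ : 1 ≤ Δ) (hdeg : ∀ r v, (G r).degree v ≤ Δ) (j : ℕ) (v : V) :
    0 ≤ collectSeq Δ l G b j v := by
  induction j generalizing v with
  | zero => simp only [collectSeq]; split_ifs <;> simp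
  | succ j ih => exact collect_nonneg hΔ (hdeg _) ih v

theorem collectSeq_le_one (hΔ : 1 ≤ Δ) (hdeg : ∀ r v, (G r).degree v ≤ Δ) (j : ℕ) {v : V}
    (hv : v ≠ l) : collectSeq Δ l G b j v ≤ 1 := by
  induction j generalizing v with
  | zero => simp [collectSeq, hv]
  | succ j ih => exact collect_le_one hΔ (hdeg _) (fun v hv => ih hv) hv

theorem potential_collectSeq_le (hconn : ∀ r, (G r).Connected) (hΔ : 1 ≤ Δ)
    (hdeg : ∀ r v, (G r).degree v ≤ Δ) (j : ℕ) :
    potential l (collectSeq Δ l G b j)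
      ≤ Fintype.card V * Real.exp (-(j / (4 * Δ * (Fintype.card V : ℝ) ^ 2))) := by
  induction j with
  | zero =>
    calc potential l (collectSeq Δ l G b 0) ≤ ∑ _v : V, (1 : ℝ) := by
          refine Finset.sum_le_sum fun v _ => ?_
          simp only [offered, collectSeq]; split_ifs <;> simp
      _ = _ := by simp
  | succ j ih =>
    have h0 : 0 ≤ potential l (collectSeq Δ l G b j) := Finset.sum_nonneg fun _ _ => sq_nonneg _
    calc potential l (collectSeq Δ l G b (j + 1))
        ≤ potential l (collectSeq Δ l G b j) * (1 - 1 / (4 * Δ * (Fintype.card V : ℝ) ^ 2)) :=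
          potential_collect_le (hconn _) hΔ (hdeg _)
      _ ≤ potential l (collectSeq Δ l G b j)
            * Real.exp (-(1 / (4 * Δ * (Fintype.card V : ℝ) ^ 2))) := by
          gcongr
          exact Real.one_sub_le_exp_neg _
      _ ≤ (Fintype.card V * Real.exp (-(j / (4 * Δ * (Fintype.card V : ℝ) ^ 2))))
            * Real.exp (-(1 / (4 * Δ * (Fintype.card V : ℝ) ^ 2))) := by
          gcongr
      _ = _ := by
          rw [mul_assoc, ← Real.exp_add]
          congr 2
          push_cast
          ring

theorem sum_offered_eq (j : ℕ) : ∑ v, offered l (collectSeq Δ l G b j) v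
    = (Fintype.card V : ℝ) - 1 - collectSeq Δ l G b j l := by
  rw [← sum_collectSeq (Δ := Δ) (l := l) (G := G) (b := b) j,
    ← Finset.add_sum_erase _ _ (Finset.mem_univ l), ← Finset.add_sum_erase _ _ (Finset.mem_univ l)]
  have : ∑ v ∈ Finset.univ.erase l, offered l (collectSeq Δ l G b j) v
      = ∑ v ∈ Finset.univ.erase l, collectSeq Δ l G b j v :=
    Finset.sum_congr rfl fun v hv => by simp [offered, Finset.ne_of_mem_erase hv]
  rw [this]
  simp [offered]

/-- This inequality is the source of n > 6: it fails at n = 6. The term 2^n accommodates the largest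
admissible c. -/
theorem mul_two_pow_succ_le_four_pow {n : ℕ} (hn : 6 < n) : n * (2 ^ n + 1) ≤ 4 ^ (n - 2) := by
  obtain ⟨m, rfl⟩ : ∃ m, n = m + 7 := ⟨n - 7, by omega⟩
  show (m + 7) * (2 ^ (m + 7) + 1) ≤ 4 ^ (m + 5)
  induction m with
  | zero => norm_num
  | succ m ih =>
    have ih := ih (by omega)
    have h2 : 1 ≤ 2 ^ (m + 7) := Nat.one_le_two_pow
    rw [show m + 1 + 7 = (m + 7) + 1 by ring, show m + 1 + 5 = (m + 5) + 1 by ring, pow_succ 2,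
      pow_succ 4]
    nlinarith

/-- With the correct estimate, hardly any energy is left outside the leader. -/
theorem sum_offered_le (hconn : ∀ r, (G r).Connected) (hΔ : 2 ≤ Δ)
    (hdeg : ∀ r v, (G r).degree v ≤ Δ) {n : ℕ} (hn : 6 < n) (hV : Fintype.card V = n) {c : ℝ}
    (hcn : c ≤ 2 ^ n) :
    ∑ v, offered l (collectSeq Δ l G b (collectionRounds Δ n)) v ≤ 1 / (n : ℝ) ^ c := by
  set x := collectSeq Δ l G b (collectionRounds Δ n) with hx
  have hD : (2 : ℝ) ≤ Δ := by exact_mod_cast hΔ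
  have hn0 : (0 : ℝ) < n := by exact_mod_cast (by omega : 0 < n)
  have hlog : 0 ≤ Real.log n := Real.log_natCast_nonneg n
  have hτ : (n : ℝ) * ((2 * (Δ : ℝ)) ^ n * Real.log n) ≤ (collectionRounds Δ n : ℝ) := by
    rw [collectionRounds]
    push_cast
    gcongr
    exact Nat.le_ceil _
  have hpow : 4 * (n : ℝ) * ((2 : ℝ) ^ n + 1) ≤ (2 * (Δ : ℝ)) ^ (n - 1) := by
    calc 4 * (n : ℝ) * ((2 : ℝ) ^ n + 1) = 4 * (n * (2 ^ n + 1)) := by ring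
      _ ≤ 4 * 4 ^ (n - 2) := by
        gcongr
        exact_mod_cast mul_two_pow_succ_le_four_pow hn
      _ = 4 ^ (n - 1) := by
        rw [← pow_succ']
        congr 1
        omega
      _ ≤ _ := by gcongr; linarith
  -- The exponent 2(1 + c) pays for two factors n, one from the initial potential and one from
  -- Cauchy–Schwarz, and leaves n^(-2c), the square of the target.
  have hexp : 2 * (1 + c) * Real.log n
      ≤ (collectionRounds Δ n : ℝ) / (4 * Δ * (n : ℝ) ^ 2) := by
    rw [le_div_iff₀ (by positivity)]
    refine le_trans ?_ hτ
    calc 2 * (1 + c) * Real.log n * (4 * Δ * (n : ℝ) ^ 2)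
        ≤ 2 * (1 + 2 ^ n) * Real.log n * (4 * Δ * (n : ℝ) ^ 2) := by gcongr
      _ = (4 * (n : ℝ) * ((2 : ℝ) ^ n + 1)) * (2 * Δ) * (n * Real.log n) := by ring
      _ ≤ (2 * (Δ : ℝ)) ^ (n - 1) * (2 * Δ) * (n * Real.log n) := by gcongr
      _ = _ := by
        rw [← pow_succ, Nat.sub_add_cancel (by omega)]
        ring
  have hpot := potential_collectSeq_le (l := l) (b := b) hconn (by omega) hdeg (collectionRounds Δ n)
  rw [hV, ← hx] at hpot
  have hsq : (∑ v, offered l x v) ^ 2 ≤ (1 / (n : ℝ) ^ c) ^ 2 := by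
    calc (∑ v, offered l x v) ^ 2 ≤ n * potential l x := by
          have := sq_sum_le_card_mul_sum_sq (s := Finset.univ) (f := offered l x)
          rwa [Finset.card_univ, hV] at this
      _ ≤ n * (n * Real.exp (-(2 * (1 + c) * Real.log n))) := by
          gcongr
          refine hpot.trans ?_
          gcongr
      _ = _ := by
          have he : Real.exp (-(2 * (1 + c) * Real.log n)) = 1 / (n ^ 2 * ((n : ℝ) ^ c) ^ 2) := by
            rw [Real.exp_neg, one_div, Real.rpow_def_of_pos hn0]
            congr 1
            rw [show 2 * (1 + c) * Real.log n
              = Real.log n + Real.log n + (Real.log n * c + Real.log n * c) by ring,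
              Real.exp_add, Real.exp_add, Real.exp_add, Real.exp_log hn0]
            ring
          rw [he]
          field_simp
  exact le_of_sq_le_sq hsq (by positivity)

end Seq

end Energy

theorem multiset_fold_max_le {s : Multiset ℝ} {a B : ℝ} :
    s.fold max a ≤ B ↔ a ≤ B ∧ ∀ x ∈ s, x ≤ B := by
  induction s using Multiset.induction with
  | empty => simp
  | cons x s ih =>
    simp only [Multiset.fold_cons_left, max_le_iff, ih, Multiset.mem_cons, forall_eq_or_imp]
    tauto

/-! ### Global state of the network through the three phases -/

section Phases

variable {V : Type*} [Fintype V] [DecidableEq V] {Δ : ℕ} {c : ℝ} {lowerTest : Bool} {l : V}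
  {G : ℕ → SimpleGraph V} [∀ r, DecidableRel (G r).Adj] {b k : ℕ}

/-- One collection round of the whole network. -/
theorem collection_round {r t : ℕ} {e : V → ℝ}
    (h : ∀ v, (countingProtocol Δ c lowerTest).run l G r v
      = ⟨decide (v = l), k, .collection, t, e v, 0, decide (v = l), false⟩) (v : V) :
    (countingProtocol Δ c lowerTest).run l G (r + 1) v =
      if t + 1 < collectionRounds Δ k then
        ⟨decide (v = l), k, .collection, t + 1, collect Δ (G r) l e v, 0, decide (v = l), false⟩
      else ⟨decide (v = l), k, .verification, 0, collect Δ (G r) l e v, collect Δ (G r) l e v,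
        decide (v = l), false⟩ := by
  have hs : ((Multiset.map Msg.value (((G r).neighborFinset v).val.map fun w =>
      countingSend ((countingProtocol Δ c lowerTest).run l G r w))).sum)
      = ∑ w ∈ (G r).neighborFinset v, offered l e w := by
    simp only [Multiset.map_map, Finset.sum, h]
    congr 1
    refine Multiset.map_congr rfl fun w _ => ?_
    simp [countingSend, Msg.value, offered]
  have hrun : (countingProtocol Δ c lowerTest).run l G (r + 1) v
      = collectionStep Δ ((countingProtocol Δ c lowerTest).run l G r v)
        (((G r).neighborFinset v).val.map fun w =>
          countingSend ((countingProtocol Δ c lowerTest).run l G r w)) := by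
    simp only [Protocol.run]
    simp only [countingProtocol] at h ⊢
    simp only [h]
    simp
  rw [hrun]
  have he : e v + (∑ w ∈ (G r).neighborFinset v, offered l e w) / (2 * (Δ : ℝ))
      - (if decide (v = l) = true then 0 else e v * ((G r).degree v : ℝ) / (2 * (Δ : ℝ)))
      = collect Δ (G r) l e v := by
    unfold collect
    by_cases hv : v = l <;> simp [offered, hv]
  simp only [collectionStep, hs]
  simp only [h, Multiset.card_map, Finset.card_val, SimpleGraph.card_neighborFinset_eq_degree, he]

theorem run_collection
    (h : ∀ v, (countingProtocol Δ c lowerTest).run l G b v = startIteration (decide (v = l)) k)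
    {j : ℕ} (hj : j < collectionRounds Δ k) (v : V) :
    (countingProtocol Δ c lowerTest).run l G (b + j) v
      = ⟨decide (v = l), k, .collection, j, collectSeq Δ l G b j v, 0, decide (v = l), false⟩ := by
  induction j generalizing v with
  | zero => simp [h, startIteration, collectSeq]
  | succ j ih =>
    rw [← add_assoc, collection_round (fun v => ih (by omega) v), if_pos hj]
    rfl

/-- The last round both updates the energies and changes the phase, so it is treated apart from
`run_collection`. It also initialises the maxima with the final energies. -/
theorem run_collection_end (hk : 0 < collectionRounds Δ k)
    (h : ∀ v, (countingProtocol Δ c lowerTest).run l G b v = startIteration (decide (v = l)) k)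
    (v : V) :
    (countingProtocol Δ c lowerTest).run l G (b + collectionRounds Δ k) v
      = ⟨decide (v = l), k, .verification, 0, collectSeq Δ l G b (collectionRounds Δ k) v,
        collectSeq Δ l G b (collectionRounds Δ k) v, decide (v = l), false⟩ := by
  obtain ⟨t, ht⟩ := Nat.exists_eq_succ_of_ne_zero hk.ne'
  rw [ht, Nat.succ_eq_add_one, ← add_assoc,
    collection_round (fun v => run_collection h (by omega) v), if_neg (by omega)]
  rfl

/-- What a node broadcasts in the verification phase when it knows of the energies `m`. -/
def verificationMsg (l : V) (m : V → ℝ) (w : V) : Msg :=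
  if w = l then .silent else .energy (m w)

/-- The largest energies known after `j` verification rounds that begin after the first `b`
rounds; the leader's value does not change. -/
noncomputable def maxSeq (l : V) (G : ℕ → SimpleGraph V) [∀ r, DecidableRel (G r).Adj] (b : ℕ)
    (e : V → ℝ) : ℕ → V → ℝ
  | 0 => e
  | j + 1 => fun v => if v = l then e l else
      ((((G (b + j)).neighborFinset v).val.map
        (verificationMsg l (maxSeq l G b e j))).map Msg.value).fold max (maxSeq l G b e j v)

/-- Whether the leader has heard only of energies at most `B` in the first `j` verification
rounds. -/
def HeardOnlySmall (l : V) (G : ℕ → SimpleGraph V) [∀ r, DecidableRel (G r).Adj] (b : ℕ)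
    (e : V → ℝ) (B : ℝ) (j : ℕ) : Prop :=
  ∀ i < j, ∀ x ∈ ((G (b + i)).neighborFinset l).val.map (verificationMsg l (maxSeq l G b e i)),
    x.value ≤ B

open Classical in
theorem verification_round {i : ℕ} {e : V → ℝ}
    (h : ∀ v, (countingProtocol Δ c lowerTest).run l G (b + i) v
      = ⟨decide (v = l), k, .verification, i, e v, maxSeq l G b e i v,
        decide (v = l ∧ HeardOnlySmall l G b e (1 / (k : ℝ) ^ c) i), false⟩) (v : V) :
    (countingProtocol Δ c lowerTest).run l G (b + i + 1) v =
      if i + 1 < verificationRounds c k then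
        ⟨decide (v = l), k, .verification, i + 1, e v, maxSeq l G b e (i + 1) v,
          decide (v = l ∧ HeardOnlySmall l G b e (1 / (k : ℝ) ^ c) (i + 1)), false⟩
      else
        ⟨decide (v = l), k, .notification, 0, e v, maxSeq l G b e (i + 1) v,
          decide (v = l ∧ HeardOnlySmall l G b e (1 / (k : ℝ) ^ c) (i + 1) ∧
            EnergyOK c lowerTest k (e l)), false⟩ := by
  have hsend : (fun w => countingSend ((countingProtocol Δ c lowerTest).run l G (b + i) w))
      = verificationMsg l (maxSeq l G b e i) := by
    funext w
    simp [h, countingSend, verificationMsg]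
  have hrun : (countingProtocol Δ c lowerTest).run l G (b + i + 1) v
      = verificationStep c lowerTest ((countingProtocol Δ c lowerTest).run l G (b + i) v)
        (((G (b + i)).neighborFinset v).val.map fun w =>
          countingSend ((countingProtocol Δ c lowerTest).run l G (b + i) w)) := by
    simp only [Protocol.run]
    simp only [countingProtocol] at h ⊢
    simp only [h]
    simp
  rw [hrun, hsend]
  by_cases hv : v = l
  · subst hv
    have hm : maxSeq v G b e i v = e v := by cases i <;> simp [maxSeq]
    have hm' : maxSeq v G b e (i + 1) v = e v := by simp [maxSeq]
    have hH : HeardOnlySmall v G b e (1 / (k : ℝ) ^ c) (i + 1)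
        ↔ HeardOnlySmall v G b e (1 / (k : ℝ) ^ c) i ∧
          ∀ x ∈ ((G (b + i)).neighborFinset v).val.map (verificationMsg v (maxSeq v G b e i)),
            x.value ≤ 1 / (k : ℝ) ^ c := by
      simp only [HeardOnlySmall, Nat.forall_lt_succ_right]
    simp only [verificationStep, h, hH, hm, hm']
    simp only [decide_true, if_true, true_and, Bool.decide_and]
  · simp [verificationStep, h, hv, maxSeq]

open Classical in
theorem run_verification {e : V → ℝ}
    (h : ∀ v, (countingProtocol Δ c lowerTest).run l G b v
      = ⟨decide (v = l), k, .verification, 0, e v, e v, decide (v = l), false⟩)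
    {j : ℕ} (hj : j < verificationRounds c k) (v : V) :
    (countingProtocol Δ c lowerTest).run l G (b + j) v
      = ⟨decide (v = l), k, .verification, j, e v, maxSeq l G b e j v,
        decide (v = l ∧ HeardOnlySmall l G b e (1 / (k : ℝ) ^ c) j), false⟩ := by
  induction j generalizing v with
  | zero => simp [h, maxSeq, HeardOnlySmall]
  | succ j ih => rw [← add_assoc, verification_round (fun v => ih (by omega) v), if_pos hj]

-- The maxima are left existential because the notification phase never reads them; only the
-- leader's verdict matters.
open Classical in
theorem run_verification_end {e : V → ℝ} (hk : 0 < verificationRounds c k)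
    (h : ∀ v, (countingProtocol Δ c lowerTest).run l G b v
      = ⟨decide (v = l), k, .verification, 0, e v, e v, decide (v = l), false⟩) :
    ∃ m : V → ℝ, ∀ v, (countingProtocol Δ c lowerTest).run l G (b + verificationRounds c k) v
      = ⟨decide (v = l), k, .notification, 0, e v, m v,
        decide (v = l ∧ HeardOnlySmall l G b e (1 / (k : ℝ) ^ c) (verificationRounds c k) ∧
          EnergyOK c lowerTest k (e l)), false⟩ := by
  obtain ⟨t, ht⟩ := Nat.exists_eq_succ_of_ne_zero hk.ne'
  refine ⟨maxSeq l G b e (t + 1), fun v => ?_⟩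
  rw [ht, Nat.succ_eq_add_one, ← add_assoc,
    verification_round (fun v => run_verification h (by omega) v), if_neg (by omega)]

/-- Which nodes know `Halt` after `j` notification rounds, if those of `S` know it at first. -/
def informed (l : V) (G : ℕ → SimpleGraph V) (b : ℕ) (S : Set V) : ℕ → Set V
  | 0 => S
  | j + 1 => {v | v ∈ informed l G b S j ∨ v ≠ l ∧ ∃ w ∈ informed l G b S j, (G (b + j)).Adj v w}

open Classical in
theorem notification_round {r t : ℕ} {e m : V → ℝ} {S : Set V}
    (h : ∀ v, (countingProtocol Δ c lowerTest).run l G r v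
      = ⟨decide (v = l), k, .notification, t, e v, m v, decide (v ∈ S), false⟩) (v : V) :
    (countingProtocol Δ c lowerTest).run l G (r + 1) v =
      if t + 1 < k then
        ⟨decide (v = l), k, .notification, t + 1, e v, m v,
          decide (v ∈ S ∨ v ≠ l ∧ ∃ w ∈ S, (G r).Adj v w), false⟩
      else if v ∈ S ∨ v ≠ l ∧ ∃ w ∈ S, (G r).Adj v w then
        ⟨decide (v = l), k, .notification, t, e v, m v, true, true⟩
      else startIteration (decide (v = l)) (k + 1) := by
  have hmem : Msg.halt ∈ (((G r).neighborFinset v).val.map fun w =>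
      countingSend ((countingProtocol Δ c lowerTest).run l G r w))
      ↔ ∃ w ∈ S, (G r).Adj v w := by
    simp only [Multiset.mem_map, Finset.mem_val, SimpleGraph.mem_neighborFinset, h]
    refine exists_congr fun w => ?_
    by_cases hw : w ∈ S <;> simp [countingSend, hw]
  have hrun : (countingProtocol Δ c lowerTest).run l G (r + 1) v
      = notificationStep ((countingProtocol Δ c lowerTest).run l G r v)
        (((G r).neighborFinset v).val.map fun w =>
          countingSend ((countingProtocol Δ c lowerTest).run l G r w)) := by
    simp only [Protocol.run]
    simp only [countingProtocol] at h ⊢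
    simp only [h]
    simp
  rw [hrun]
  have hf : (if decide (v = l) = true then decide (v ∈ S)
      else decide (v ∈ S) || decide (∃ w ∈ S, (G r).Adj v w))
      = decide (v ∈ S ∨ v ≠ l ∧ ∃ w ∈ S, (G r).Adj v w) := by
    by_cases hv : v = l <;> simp [hv]
  simp only [notificationStep, hmem]
  simp only [h, hf]
  by_cases hS : v ∈ S ∨ v ≠ l ∧ ∃ w ∈ S, (G r).Adj v w <;> simp [hS]

open Classical in
theorem run_notification {e m : V → ℝ} {S : Set V}
    (h : ∀ v, (countingProtocol Δ c lowerTest).run l G b v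
      = ⟨decide (v = l), k, .notification, 0, e v, m v, decide (v ∈ S), false⟩)
    {j : ℕ} (hj : j < k) (v : V) :
    (countingProtocol Δ c lowerTest).run l G (b + j) v
      = ⟨decide (v = l), k, .notification, j, e v, m v, decide (v ∈ informed l G b S j),
        false⟩ := by
  induction j generalizing v with
  | zero =>
    simp only [add_zero, h, informed]
    congr
  | succ j ih =>
    rw [← add_assoc, notification_round (fun v => ih (by omega) v), if_pos hj]
    congr 1
    exact decide_eq_decide.2 Iff.rfl

-- The set S covers both outcomes of verification: empty after rejection, {l} after acceptance. A
-- node that halts does not advance its counter, whence k - 1.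
open Classical in
theorem run_notification_end {e m : V → ℝ} {S : Set V} (hk : 0 < k)
    (h : ∀ v, (countingProtocol Δ c lowerTest).run l G b v
      = ⟨decide (v = l), k, .notification, 0, e v, m v, decide (v ∈ S), false⟩) (v : V) :
    (countingProtocol Δ c lowerTest).run l G (b + k) v
      = if v ∈ informed l G b S k then
          ⟨decide (v = l), k, .notification, k - 1, e v, m v, true, true⟩
        else startIteration (decide (v = l)) (k + 1) := by
  obtain ⟨t, rfl⟩ := Nat.exists_eq_succ_of_ne_zero hk.ne'
  rw [Nat.succ_eq_add_one, ← add_assoc,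
    notification_round (fun v => run_notification h (by omega) v), if_neg (by omega)]
  exact if_congr Iff.rfl rfl rfl

omit [Fintype V] [DecidableEq V] [∀ r, DecidableRel (G r).Adj] in
theorem informed_empty (j : ℕ) : informed l G b ∅ j = ∅ := by
  induction j with
  | zero => rfl
  | succ j ih => simp [informed, ih]

omit [∀ r, DecidableRel (G r).Adj] in
/-- On connected graphs `Halt` reaches a new node in every round, until all have it. -/
theorem exists_card_le_informed (hconn : ∀ r, (G r).Connected) (j : ℕ) :
    ∃ T : Finset V, l ∈ T ∧ (↑T ⊆ informed l G b {l} j) ∧ min (Fintype.card V) (j + 1) ≤ T.card := by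
  induction j with
  | zero => exact ⟨{l}, by simp, by simp [informed], by simp⟩
  | succ j ih =>
    obtain ⟨T, hl, hT, hc⟩ := ih
    have hmono : (T : Set V) ⊆ informed l G b {l} (j + 1) := fun v hv => Or.inl (hT hv)
    by_cases hu : T = Finset.univ
    · exact ⟨T, hl, hmono, by simp [hu]⟩
    · obtain ⟨u, hu, w, hw, ha⟩ := exists_adj_of_connected (hconn (b + j)) hl hu
      refine ⟨insert w T, by simp [hl], ?_, ?_⟩
      · rw [Finset.coe_insert, Set.insert_subset_iff]
        exact ⟨Or.inr ⟨fun e => hw (e ▸ hl), u, hT hu, ha.symm⟩, hmono⟩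
      · rw [Finset.card_insert_of_notMem hw]
        omega

omit [∀ r, DecidableRel (G r).Adj] in
theorem mem_informed_of_card_le (hconn : ∀ r, (G r).Connected) (hk : Fintype.card V ≤ k) (v : V) :
    v ∈ informed l G b {l} k := by
  obtain ⟨T, -, hT, hc⟩ := exists_card_le_informed (l := l) (b := b) hconn k
  have : T = Finset.univ := (Finset.card_eq_iff_eq_univ T).1
    (le_antisymm (Finset.card_le_univ T) (by omega))
  exact hT (by simp [this])

theorem run_of_halted {r : ℕ} {v : V}
    (h : ((countingProtocol Δ c lowerTest).run l G r v).halted = true) {s : ℕ} (hs : r ≤ s) :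
    (countingProtocol Δ c lowerTest).run l G s v = (countingProtocol Δ c lowerTest).run l G r v := by
  induction s, hs using Nat.le_induction with
  | base => rfl
  | succ s _ ih =>
    rw [← ih] at h
    rw [← ih]
    simp only [Protocol.run]
    simp only [countingProtocol] at h ⊢
    simp only [h, if_true]

/-- If the leader rejects nothing in `j` verification rounds, then at least `j` nodes other than
the leader, or all of them, have small energy. -/
theorem HeardOnlySmall.exists_card_le (hconn : ∀ r, (G r).Connected) {e : V → ℝ} {B : ℝ} {j : ℕ}
    (h : HeardOnlySmall l G b e B j) :
    ∃ T : Finset V, l ∈ T ∧ min (Fintype.card V) (j + 1) ≤ T.card ∧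
      ∀ v ∈ T, v ≠ l → e v ≤ B := by
  -- Induction on i goes back in time from round j. A small maximum after a round forces small
  -- maxima before it, at the node and at its non-leader neighbours; the leader's neighbours are
  -- small because it heard them. An edge leaving T therefore adds a node.
  have key : ∀ i ≤ j, ∃ T : Finset V, l ∈ T ∧ min (Fintype.card V) (i + 1) ≤ T.card ∧
      ∀ v ∈ T, v ≠ l → maxSeq l G b e (j - i) v ≤ B := by
    intro i
    induction i with
    | zero => exact fun _ => ⟨{l}, by simp, by simp, by simp⟩
    | succ i ih =>
      intro hi
      obtain ⟨T, hl, hc, hT⟩ := ih (by omega)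
      obtain ⟨a, ha⟩ : ∃ a, a + 1 = j - i := ⟨j - i - 1, by omega⟩
      have ha' : j - (i + 1) = a := by omega
      rw [ha']
      rw [← ha] at hT
      have hstep : ∀ v ∈ T, v ≠ l → maxSeq l G b e a v ≤ B ∧
          ∀ w, (G (b + a)).Adj v w → w ≠ l → maxSeq l G b e a w ≤ B := by
        intro v hv hvl
        have := hT v hv hvl
        simp only [maxSeq, if_neg hvl, multiset_fold_max_le] at this
        refine ⟨this.1, fun w hw hwl => ?_⟩
        refine this.2 _ ?_
        simp only [Multiset.map_map, Multiset.mem_map, Finset.mem_val,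
          SimpleGraph.mem_neighborFinset]
        exact ⟨w, hw, by simp [verificationMsg, hwl, Msg.value]⟩
      have hlead : ∀ w, (G (b + a)).Adj l w → w ≠ l → maxSeq l G b e a w ≤ B := by
        intro w hw hwl
        have := h a (by omega) (verificationMsg l (maxSeq l G b e a) w)
          (Multiset.mem_map_of_mem _ (by simpa using hw))
        simpa [verificationMsg, hwl, Msg.value] using this
      by_cases hu : T = Finset.univ
      · exact ⟨T, hl, by simp [hu], fun v hv hvl => (hstep v hv hvl).1⟩
      · obtain ⟨u, hu, w, hw, hadj⟩ := exists_adj_of_connected (hconn (b + a)) hl hu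
        have hwl : w ≠ l := fun e => hw (e ▸ hl)
        refine ⟨insert w T, by simp [hl], ?_, ?_⟩
        · rw [Finset.card_insert_of_notMem hw]
          omega
        · intro v hv hvl
          rcases Finset.mem_insert.1 hv with rfl | hv
          · by_cases hul : u = l
            · exact hlead v (hul ▸ hadj) hvl
            · exact (hstep u hu hul).2 v hadj hvl
          · exact (hstep v hv hvl).1
  obtain ⟨T, hl, hc, hT⟩ := key j le_rfl
  exact ⟨T, hl, hc, by simpa [maxSeq] using hT⟩

/-- The leader rejects nothing if all energies are small. -/
theorem HeardOnlySmall.of_le {e : V → ℝ} {B : ℝ} (hB : 0 ≤ B)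
    (h : ∀ v, v ≠ l → e v ≤ B) (j : ℕ) : HeardOnlySmall l G b e B j := by
  have hmsg : ∀ m : V → ℝ, (∀ v, v ≠ l → m v ≤ B) → ∀ w, (verificationMsg l m w).value ≤ B := by
    intro m hm w
    by_cases hw : w = l
    · simpa [verificationMsg, hw, Msg.value] using hB
    · simpa [verificationMsg, hw, Msg.value] using hm w hw
  have hmax : ∀ i v, v ≠ l → maxSeq l G b e i v ≤ B := by
    intro i
    induction i with
    | zero => exact h
    | succ i ih =>
      intro v hv
      simp only [maxSeq, if_neg hv, multiset_fold_max_le]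
      refine ⟨ih v hv, fun x hx => ?_⟩
      simp only [Multiset.map_map, Multiset.mem_map] at hx
      obtain ⟨w, -, rfl⟩ := hx
      exact hmsg _ ih w
  intro i _ x hx
  obtain ⟨w, -, rfl⟩ := Multiset.mem_map.1 hx
  exact hmsg _ (hmax i) w

end Phases

/-! ### Bounds on the number of rounds -/

/-- The number of rounds of the iteration for the estimate `k`. -/
noncomputable def iterationRounds (Δ : ℕ) (c : ℝ) (k : ℕ) : ℕ :=
  collectionRounds Δ k + verificationRounds c k + k

/-- The strict inequality is the role of c > 1: it gives k · k^(-c) < 1, the contradiction in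
`not_accept_of_lt` when all nodes are known to be small. -/
theorem one_div_rpow_lt {c : ℝ} (hc : 1 < c) {k : ℕ} (hk : 2 ≤ k) :
    1 / (k : ℝ) ^ c < 1 / k := by
  have hk' : (1 : ℝ) < k := by exact_mod_cast hk
  have := Real.rpow_lt_rpow_of_exponent_lt hk' hc
  rw [Real.rpow_one] at this
  exact one_div_lt_one_div_of_lt (by linarith) this

theorem verificationRounds_pos {c : ℝ} (hc : 1 < c) {k : ℕ} (hk : 2 ≤ k) :
    0 < verificationRounds c k := by
  have hk' : (2 : ℝ) ≤ k := by exact_mod_cast hk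
  have hB := one_div_rpow_lt hc hk
  have h1 : 1 / (k : ℝ) ≤ 1 := by rw [div_le_one (by linarith)]; linarith
  have h0 : 0 ≤ (k : ℝ) / (1 - 1 / (k : ℝ) ^ c) := div_nonneg (by linarith) (by linarith)
  exact Nat.ceil_pos.2 (by linarith)

theorem verificationRounds_le {c : ℝ} (hc : 1 < c) {k : ℕ} (hk : 2 ≤ k) :
    verificationRounds c k ≤ k + 3 := by
  have hk' : (2 : ℝ) ≤ k := by exact_mod_cast hk
  have hB := one_div_rpow_lt hc hk
  have h1 : 1 / (k : ℝ) ≤ 1 / 2 := one_div_le_one_div_of_le (by norm_num) hk'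
  have h2 : (k : ℝ) * (1 / k) = 1 := by field_simp
  have h3 : (k : ℝ) / (1 - 1 / (k : ℝ) ^ c) ≤ k + 2 := by
    rw [div_le_iff₀ (by linarith)]
    nlinarith
  refine Nat.ceil_le.2 ?_
  push_cast
  linarith

theorem collectionRounds_pos {Δ k : ℕ} (hΔ : 1 ≤ Δ) (hk : 2 ≤ k) : 0 < collectionRounds Δ k := by
  have hk' : (1 : ℝ) < k := by exact_mod_cast hk
  have hD : (0 : ℝ) < Δ := by exact_mod_cast hΔ
  have := Real.log_pos hk'
  exact Nat.mul_pos (by omega) (Nat.ceil_pos.2 (by positivity))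

theorem iterationRounds_le {Δ k : ℕ} {c : ℝ} (hc : 1 < c) (hk : 2 ≤ k) :
    (iterationRounds Δ c k : ℝ) ≤ k * (2 * (Δ : ℝ)) ^ k * Real.log k + 3 * k + 3 := by
  have hlog : 0 ≤ Real.log k := Real.log_natCast_nonneg k
  have h1 : (collectionRounds Δ k : ℝ) ≤ k * ((2 * (Δ : ℝ)) ^ k * Real.log k + 1) := by
    rw [collectionRounds]
    push_cast
    gcongr
    exact (Nat.ceil_lt_add_one (by positivity)).le
  have h2 : (verificationRounds c k : ℝ) ≤ k + 3 := by exact_mod_cast verificationRounds_le hc hk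
  rw [iterationRounds]
  push_cast
  linarith

/-- Let X be the leading term of the newest iteration. As 2Δ ≥ 4, the earlier iterations cost at
most X/2, and the linear terms at most another X/2, which gives 2X in all. -/
theorem sum_iterationRounds_le {Δ : ℕ} {c : ℝ} (hc : 1 < c) (hΔ : 2 ≤ Δ) {m : ℕ} (hm : 1 ≤ m) :
    ((∑ k ∈ Finset.Ico 2 (m + 1), iterationRounds Δ c k : ℕ) : ℝ)
      ≤ 2 * (2 * (Δ : ℝ)) ^ m * (m + 1) * Real.log (m + 1) := by
  have hD : (4 : ℝ) ≤ 2 * Δ := by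
    have : (2 : ℝ) ≤ Δ := by exact_mod_cast hΔ
    linarith
  induction m, hm using Nat.le_induction with
  | base =>
    have : 0 ≤ Real.log ((1 : ℕ) + 1 : ℝ) := Real.log_nonneg (by norm_num)
    simp only [Nat.reduceAdd, Finset.Ico_self, Finset.sum_empty, Nat.cast_zero]
    positivity
  | succ m hm ih =>
    have hm' : (1 : ℝ) ≤ m := by exact_mod_cast hm
    rw [Finset.sum_Ico_succ_top (by omega)]
    have hi := iterationRounds_le (Δ := Δ) hc (show 2 ≤ m + 1 by omega)
    push_cast at hi ih ⊢
    set D : ℝ := 2 * (Δ : ℝ) with hDdef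
    set L := Real.log ((m : ℝ) + 1) with hL
    have hL2 : 0.6931 ≤ L := by
      have h1 : Real.log 2 ≤ L := Real.log_le_log (by norm_num) (by linarith)
      have h2 := Real.log_two_gt_d9
      linarith
    have hLL : L ≤ Real.log ((m : ℝ) + 1 + 1) := Real.log_le_log (by linarith) (by linarith)
    have hpow : 4 * D ^ m ≤ D ^ (m + 1) := by
      rw [pow_succ']
      gcongr
    have h16 : 16 ≤ D ^ (m + 1) := by
      calc (16 : ℝ) = 4 ^ 2 := by norm_num
        _ ≤ D ^ 2 := by gcongr
        _ ≤ D ^ (m + 1) := pow_le_pow_right₀ (by linarith) (by omega)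
    have hX : 0 ≤ ((m : ℝ) + 1) * L := by positivity
    have h1 : 2 * D ^ m * (m + 1) * L ≤ D ^ (m + 1) * ((m + 1) * L) / 2 := by
      nlinarith [mul_le_mul_of_nonneg_right hpow hX]
    have h2 : 3 * (m : ℝ) + 6 ≤ D ^ (m + 1) * ((m + 1) * L) / 2 := by
      have h3 := mul_le_mul_of_nonneg_right h16 hX
      have h4 : ((m : ℝ) + 1) * 0.6931 ≤ (m + 1) * L := by gcongr
      linarith
    have h5 : D ^ (m + 1) * ((m + 1) * L) ≤ D ^ (m + 1) * ((m + 1 + 1) * Real.log (m + 1 + 1)) := by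
      gcongr
      linarith
    linarith

/-- The spare factor 2Δ in the target exceeds 2 ln(2Δ), because ln(2Δ) ≤ ln 2 + Δ - 1 < Δ. -/
theorem sum_iterationRounds_lt {Δ : ℕ} {c : ℝ} (hc : 1 < c) (hΔ : 2 ≤ Δ) {n : ℕ} (hn : 1 ≤ n) :
    ((∑ k ∈ Finset.Ico 2 (n + 1), iterationRounds Δ c k : ℕ) : ℝ)
      < (2 * (Δ : ℝ)) ^ (n + 1) * ((n : ℝ) + 1) * Real.log ((n : ℝ) + 1)
        / Real.log (2 * (Δ : ℝ)) := by
  refine (sum_iterationRounds_le hc hΔ hn).trans_lt ?_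
  have hD : (2 : ℝ) ≤ Δ := by exact_mod_cast hΔ
  have hn' : (1 : ℝ) ≤ n := by exact_mod_cast hn
  have hL : 0 < Real.log ((n : ℝ) + 1) := Real.log_pos (by linarith)
  have hlog : Real.log (2 * (Δ : ℝ)) < Δ := by
    rw [Real.log_mul (by norm_num) (by linarith)]
    have h1 := Real.log_le_sub_one_of_pos (show (0 : ℝ) < Δ by linarith)
    have h2 := Real.log_two_lt_d9
    linarith
  rw [lt_div_iff₀ (Real.log_pos (by linarith))]
  calc 2 * (2 * (Δ : ℝ)) ^ n * (n + 1) * Real.log (n + 1) * Real.log (2 * Δ)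
      < 2 * (2 * (Δ : ℝ)) ^ n * (n + 1) * Real.log (n + 1) * Δ := by gcongr
    _ = _ := by ring

/-! ### Outcome of an iteration and induction on the estimate -/

section Iteration

variable {V : Type*} [Fintype V] [DecidableEq V] {Δ : ℕ} {c : ℝ} {lowerTest : Bool} {l : V}
  {G : ℕ → SimpleGraph V} [∀ r, DecidableRel (G r).Adj] {b k : ℕ}

/-- The leader cannot accept an estimate that is too small. -/
theorem not_accept_of_lt (hΔ : 1 ≤ Δ) (hc : 1 < c) (hconn : ∀ r, (G r).Connected)
    (hdeg : ∀ r v, (G r).degree v ≤ Δ) (hk : 2 ≤ k) (hkn : k < Fintype.card V) {a j : ℕ} :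
    ¬ (HeardOnlySmall l G a (collectSeq Δ l G b j) (1 / (k : ℝ) ^ c) (verificationRounds c k) ∧
      EnergyOK c lowerTest k (collectSeq Δ l G b j l)) := by
  -- Only the upper test of the leader's energy is needed for rejection, so both variants of the
  -- protocol are covered.
  rintro ⟨hH, hE, -⟩
  obtain ⟨T, hl, hcard, hT⟩ := hH.exists_card_le hconn
  set e := collectSeq Δ l G b j with he
  set B := 1 / (k : ℝ) ^ c with hB
  have hk' : (2 : ℝ) ≤ k := by exact_mod_cast hk
  have hBk : B < 1 / k := one_div_rpow_lt hc hk
  have hk2 : 1 / (k : ℝ) ≤ 1 / 2 := one_div_le_one_div_of_le (by norm_num) hk'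
  have hkk : (k : ℝ) * (1 / k) = 1 := by field_simp
  have hB1 : 0 < 1 - B := by linarith
  have hsum : ∑ v, e v = (Fintype.card V : ℝ) - 1 := sum_collectSeq j
  have hsplit : ∑ v, e v = e l + ∑ v ∈ T.erase l, e v + ∑ v ∈ Tᶜ, e v := by
    rw [Finset.add_sum_erase _ _ hl, Finset.sum_add_sum_compl]
  have hsmall : ∑ v ∈ T.erase l, e v ≤ ((T.card : ℝ) - 1) * B := by
    calc _ ≤ ∑ _v ∈ T.erase l, B := Finset.sum_le_sum fun v hv =>
          hT v (Finset.mem_of_mem_erase hv) (Finset.ne_of_mem_erase hv)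
      _ = _ := by
        rw [Finset.sum_const, Finset.card_erase_of_mem hl, nsmul_eq_mul,
          Nat.cast_sub (Finset.card_pos.2 ⟨l, hl⟩), Nat.cast_one]
  have hrest : ∑ v ∈ Tᶜ, e v ≤ (Fintype.card V : ℝ) - T.card := by
    calc _ ≤ ∑ _v ∈ Tᶜ, (1 : ℝ) := Finset.sum_le_sum fun v hv =>
          collectSeq_le_one hΔ hdeg j (ne_of_mem_of_not_mem hl (Finset.mem_compl.1 hv)).symm
      _ = _ := by
        rw [Finset.sum_const, Finset.card_compl, nsmul_eq_mul,
          Nat.cast_sub (Finset.card_le_univ T), mul_one]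
  have hE' : e l ≤ (k : ℝ) - 1 := hE
  -- Adding the three bounds to the conserved total n - 1 makes n cancel.
  have hle : ((T.card : ℝ) - 1) * (1 - B) ≤ k - 1 := by linarith
  -- Either T is everything, so |T| - 1 ≥ k and kB < 1 is violated, or |T| - 1 is at least the
  -- number of verification rounds, hence at least 1 + k/(1 - B).
  rcases min_le_iff.1 hcard with h | h
  · have h' : (k : ℝ) ≤ T.card - 1 := by
      have : ((k + 1 : ℕ) : ℝ) ≤ T.card := by exact_mod_cast (show k + 1 ≤ T.card by omega)
      push_cast at this
      linarith
    nlinarith [mul_le_mul_of_nonneg_right h' hB1.le]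
  · have h1 : 1 + (k : ℝ) / (1 - B) ≤ verificationRounds c k := Nat.le_ceil _
    have h2 : ((verificationRounds c k + 1 : ℕ) : ℝ) ≤ T.card := by exact_mod_cast h
    push_cast at h2
    have h3 : 1 + (k : ℝ) / (1 - B) ≤ (T.card : ℝ) - 1 := by linarith
    have h4 := mul_le_mul_of_nonneg_right h3 hB1.le
    rw [add_mul, div_mul_cancel₀ _ hB1.ne'] at h4
    linarith

/-- The leader accepts the correct estimate. -/
theorem accept_card (hconn : ∀ r, (G r).Connected) (hΔ : 2 ≤ Δ)
    (hdeg : ∀ r v, (G r).degree v ≤ Δ) {n : ℕ} (hn : 6 < n) (hV : Fintype.card V = n)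
    (hcn : c ≤ 2 ^ n) {a : ℕ} :
    HeardOnlySmall l G a (collectSeq Δ l G b (collectionRounds Δ n)) (1 / (n : ℝ) ^ c)
        (verificationRounds c n) ∧
      EnergyOK c lowerTest n (collectSeq Δ l G b (collectionRounds Δ n) l) := by
  have hnn := collectSeq_nonneg (l := l) (b := b) (by omega) hdeg (collectionRounds Δ n)
  have hle := sum_offered_le (l := l) (b := b) hconn hΔ hdeg hn hV hcn
  have heq := sum_offered_eq (Δ := Δ) (l := l) (G := G) (b := b) (collectionRounds Δ n)
  have h0 := Finset.sum_nonneg fun v (_ : v ∈ Finset.univ) => offered_nonneg (l := l) hnn v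
  rw [hV] at heq
  -- The leader holds n - 1 minus the remaining energy, which lies between 0 and n^(-c); this
  -- settles both the upper and the lower test.
  refine ⟨HeardOnlySmall.of_le (by positivity) (fun v hv => ?_) _, by linarith, fun _ => by linarith⟩
  calc collectSeq Δ l G b (collectionRounds Δ n) v
      = offered l (collectSeq Δ l G b (collectionRounds Δ n)) v := by simp [offered, hv]
    _ ≤ ∑ v, offered l (collectSeq Δ l G b (collectionRounds Δ n)) v :=
      Finset.single_le_sum (fun v _ => offered_nonneg hnn v) (Finset.mem_univ v)
    _ ≤ _ := hle

open Classical in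
/-- The iteration for the estimate `k`, up to the beginning of the notification phase. -/
theorem run_before_notification (hΔ : 1 ≤ Δ) (hc : 1 < c) (hk : 2 ≤ k)
    (h : ∀ v, (countingProtocol Δ c lowerTest).run l G b v = startIteration (decide (v = l)) k) :
    ∃ (e m : V → ℝ), ∀ v, (countingProtocol Δ c lowerTest).run l G
        (b + (collectionRounds Δ k + verificationRounds c k)) v
      = ⟨decide (v = l), k, .notification, 0, e v, m v,
        decide (v = l ∧ HeardOnlySmall l G (b + collectionRounds Δ k)
            (collectSeq Δ l G b (collectionRounds Δ k)) (1 / (k : ℝ) ^ c)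
            (verificationRounds c k) ∧
          EnergyOK c lowerTest k (collectSeq Δ l G b (collectionRounds Δ k) l)), false⟩ := by
  obtain ⟨m, hm⟩ := run_verification_end (verificationRounds_pos hc hk)
    (run_collection_end (collectionRounds_pos hΔ hk) h)
  exact ⟨_, m, fun v => by rw [← add_assoc]; exact hm v⟩

theorem run_iteration_of_lt (hΔ : 1 ≤ Δ) (hc : 1 < c) (hconn : ∀ r, (G r).Connected)
    (hdeg : ∀ r v, (G r).degree v ≤ Δ) (hk : 2 ≤ k) (hkn : k < Fintype.card V)
    (h : ∀ v, (countingProtocol Δ c lowerTest).run l G b v = startIteration (decide (v = l)) k)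
    (v : V) :
    (countingProtocol Δ c lowerTest).run l G (b + iterationRounds Δ c k) v
      = startIteration (decide (v = l)) (k + 1) := by
  obtain ⟨e, m, hm⟩ := run_before_notification hΔ hc hk h
  have := run_notification_end (k := k) (e := e) (m := m) (S := ∅) (by omega)
    (fun v => by
      rw [hm v]
      simp only [not_accept_of_lt hΔ hc hconn hdeg hk hkn, and_false, Set.mem_empty_iff_false]) v
  rw [iterationRounds, ← add_assoc, this, informed_empty, if_neg (Set.notMem_empty v)]

theorem run_iteration_card (hΔ : 2 ≤ Δ) (hc : 1 < c) (hconn : ∀ r, (G r).Connected)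
    (hdeg : ∀ r v, (G r).degree v ≤ Δ) {n : ℕ} (hn : 6 < n) (hV : Fintype.card V = n)
    (hcn : c ≤ 2 ^ n)
    (h : ∀ v, (countingProtocol Δ c lowerTest).run l G b v = startIteration (decide (v = l)) n)
    (v : V) :
    ((countingProtocol Δ c lowerTest).run l G (b + iterationRounds Δ c n) v).halted = true ∧
      ((countingProtocol Δ c lowerTest).run l G (b + iterationRounds Δ c n) v).k = n := by
  obtain ⟨e, m, hm⟩ := run_before_notification (by omega) hc (by omega) h
  have := run_notification_end (k := n) (e := e) (m := m) (S := {l}) (by omega)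
    (fun v => by
      rw [hm v]
      congr 1
      exact decide_eq_decide.2 (and_iff_left (accept_card hconn hΔ hdeg hn hV hcn))) v
  rw [iterationRounds, ← add_assoc, this, if_pos (mem_informed_of_card_le hconn hV.le v)]
  exact ⟨rfl, rfl⟩

/-- Every estimate below n is rejected by all nodes in the same round, so the network enters each
new iteration synchronously and with no node stopped. -/
theorem run_start (hΔ : 1 ≤ Δ) (hc : 1 < c) (hconn : ∀ r, (G r).Connected)
    (hdeg : ∀ r v, (G r).degree v ≤ Δ) (hk : 2 ≤ k) (hkn : k ≤ Fintype.card V) (v : V) :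
    (countingProtocol Δ c lowerTest).run l G (∑ i ∈ Finset.Ico 2 k, iterationRounds Δ c i) v
      = startIteration (decide (v = l)) k := by
  induction k, hk using Nat.le_induction generalizing v with
  | base => simp [Protocol.run, countingProtocol]
  | succ k hk ih =>
    rw [Finset.sum_Ico_succ_top hk]
    exact run_iteration_of_lt hΔ hc hconn hdeg hk (by omega) (fun v => ih (by omega) v) v

omit [DecidableEq V] in
/-- A connected graph with more than two nodes has a node of degree at least two. -/
theorem two_le_of_degree_le {H : SimpleGraph V} [DecidableRel H.Adj] (hH : H.Connected)
    (hV : 2 < Fintype.card V) (hdeg : ∀ v, H.degree v ≤ Δ) : 2 ≤ Δ := by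
  classical
  obtain ⟨a⟩ := hH.nonempty
  obtain ⟨u, hu, w, hw, h1⟩ := exists_adj_of_connected hH (Finset.mem_singleton_self a)
    (fun h => by
      have := congrArg Finset.card h
      rw [Finset.card_singleton, Finset.card_univ] at this
      omega)
  obtain rfl := Finset.mem_singleton.1 hu
  have hwu : w ≠ u := by simpa using hw
  -- This edge leaves the pair {u, w}, so its end inside the pair has two distinct neighbours.
  obtain ⟨x, hx, y, hy, h2⟩ := exists_adj_of_connected hH (Finset.mem_insert_self u {w})
    (fun h => by
      have := congrArg Finset.card h
      rw [Finset.card_pair hwu.symm, Finset.card_univ] at this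
      omega)
  obtain ⟨hyu, hyw⟩ : y ≠ u ∧ y ≠ w := by simpa using hy
  rcases Finset.mem_insert.1 hx with rfl | hx
  · refine le_trans ?_ (hdeg x)
    rw [← H.card_neighborFinset_eq_degree, ← Finset.card_pair hyw]
    exact Finset.card_le_card (by simp [Finset.insert_subset_iff, h1, h2])
  · obtain rfl := Finset.mem_singleton.1 hx
    refine le_trans ?_ (hdeg x)
    rw [← H.card_neighborFinset_eq_degree, ← Finset.card_pair hyu]
    exact Finset.card_le_card (by simp [Finset.insert_subset_iff, h1.symm, h2])

end Iteration

end AnonDynNet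

theorem mainTheorem2 {V : Type*} [Fintype V] [DecidableEq V] (n Δ : ℕ) (c : ℝ) (lowerTest : Bool)
    (hn : 6 < n) (hV : Fintype.card V = n) (hΔ : 1 ≤ Δ) (hΔn : Δ ≤ n - 1)
    (hc : 1 < c) (hcn : c ≤ 2 ^ n)
    (l : V) (G : ℕ → SimpleGraph V) [∀ r, DecidableRel (G r).Adj]
    (hconn : ∀ r, (G r).Connected) (hdeg : ∀ r v, (G r).degree v ≤ Δ) :
    ∃ r : ℕ,
      (r : ℝ) < (2 * (Δ : ℝ)) ^ (n + 1) * ((n : ℝ) + 1) * Real.log ((n : ℝ) + 1)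
        / Real.log (2 * (Δ : ℝ)) ∧
      ∀ s, r ≤ s → ∀ v : V,
        ((AnonDynNet.countingProtocol Δ c lowerTest).run l G s v).output = some n := by
  -- Excluding Δ = 1 provides 2Δ ≥ 4, on which both the energy decay and the round count rest.
  have hΔ2 : 2 ≤ Δ := AnonDynNet.two_le_of_degree_le (hconn 0) (by omega) (hdeg 0)
  refine ⟨∑ k ∈ Finset.Ico 2 (n + 1), AnonDynNet.iterationRounds Δ c k,
    AnonDynNet.sum_iterationRounds_lt hc hΔ2 (by omega), fun s hs v => ?_⟩
  rw [Finset.sum_Ico_succ_top (by omega)] at hs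
  obtain ⟨h1, h2⟩ := AnonDynNet.run_iteration_card (lowerTest := lowerTest) hΔ2 hc hconn hdeg hn hV
    hcn (AnonDynNet.run_start hΔ hc hconn hdeg (by omega) hV.ge) v
  rw [AnonDynNet.run_of_halted h1 hs, AnonDynNet.State.output, if_pos h1, h2]
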